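/- Let $n>m>0$ be integers. A trinomial $a\zeta^n+b\zeta^m+c$ with non-zero complex coefficients is called Schur stable if all of its complex roots have modulus strictly less than one. This property depends only on the point $[a:b:c]$ of the complex projective plane $\mathbb{P}^2_{\mathbb{C}}$; let $$\Omega_n=\{[a:b:c]\in\mathbb{P}^2_{\mathbb{C}} : a,b,c\neq 0 \text{ and } a\zeta^n+b\zeta^m+c \text{ is Schur stable}\}.$$ Assume that $m=n-1$ (so $n\ge 2$) and let $c$ be a real number with $0<c<1$. (i) If $n$ is odd, then $[1:1:c]\notin\Omega_n$; moreover, $[1:1:-c]\in\Omega_n$ if and only if $$\frac{(n-1)\pi}{2n-1}<\arccos\left(\frac c2\right)<\frac{\pi}{2}.$$ (ii) If $n$ is even, then $[1:1:-c]\notin\Omega_n$; moreover, $[1:1:c]\in\Omega_n$ if and only if $$\frac{(n-1)\pi}{2n-1}<\arccos\left(\frac c2\right)<\frac{\pi}{2}.$$ -/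

import Mathlib

namespace Trinomial

/-- The trinomial `a ζ ^ n + b ζ ^ m + c` is Schur stable: all of its complex roots have modulus
strictly less than one. -/
def IsSchurStable (n m : ℕ) (a b c : ℂ) : Prop :=
  ∀ ζ : ℂ, a * ζ ^ n + b * ζ ^ m + c = 0 → ‖ζ‖ < 1

/-- The stability region in the complex projective plane: the points `[a : b : c]` with non-zero
coordinates (the standing convention on trinomials) such that `a ζ ^ n + b ζ ^ m + c` is Schur
stable. -/
def stabilityRegion (n m : ℕ) : Set (Projectivization ℂ (Fin 3 → ℂ)) :=
  {p | ∃ (a b c : ℂ) (h : ![a, b, c] ≠ 0), a ≠ 0 ∧ b ≠ 0 ∧ c ≠ 0 ∧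
    p = Projectivization.mk ℂ ![a, b, c] h ∧ IsSchurStable n m a b c}

theorem vec_ne_zero (b c : ℂ) : (![1, b, c] : Fin 3 → ℂ) ≠ 0 := fun h => by
  simpa using congrFun h 0

/-- The point `[1 : b : c]` of the complex projective plane. -/
noncomputable def point (b c : ℂ) : Projectivization ℂ (Fin 3 → ℂ) :=
  Projectivization.mk ℂ ![1, b, c] (vec_ne_zero b c)

/-- Membership in the stability region is tested on the normalized representative. -/
theorem point_mem_stabilityRegion_iff (n m : ℕ) {b c : ℂ} (hb : b ≠ 0) (hc : c ≠ 0) :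
    point b c ∈ stabilityRegion n m ↔ IsSchurStable n m 1 b c := by
  constructor
  · rintro ⟨a', b', c', h, ha, -, -, hp, hs⟩ ζ hζ
    obtain ⟨u, hu⟩ := (Projectivization.mk_eq_mk_iff' ℂ _ _ (vec_ne_zero b c) h).1 hp
    have h0 : u * a' = 1 := by simpa using congrFun hu 0
    have h1 : u * b' = b := by simpa using congrFun hu 1
    have h2 : u * c' = c := by simpa using congrFun hu 2
    have hu0 : u ≠ 0 := by
      rintro rfl
      simp at h0
    apply hs
    apply (mul_eq_zero.1 (_ : u * (a' * ζ ^ n + b' * ζ ^ m + c') = 0)).resolve_left hu0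
    rw [← hζ, ← h0, ← h1, ← h2]
    ring
  · intro hs
    exact ⟨1, b, c, vec_ne_zero b c, one_ne_zero, hb, hc, rfl, hs⟩

end Trinomial

namespace Trinomial

/-! With `k = n - 1` and `ζ = -w`, everything reduces to `w ^ (k + 1) - w ^ k ± c`. The minus sign
gives a real root at least 1. For the plus sign, divide by `w ^ k`: a root `w = r e^{iθ}` lies on
the curve `r sin((k+1)θ) = sin(kθ)` and satisfies `|1 - w| = c / r ^ k`. If `r ≥ 1` and `c` is below
`2 sin(π / (2(2k+1)))`, the distance bound forces `|θ| < π / (2k+1)`, where the curve is inside the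
disc (`norm_lt_one_of_root`). Otherwise the intermediate value theorem finds a root on the part of
the curve with `r ≥ 1` (`exists_root_one_le_norm`). -/

open Complex in
/-- A root of `w ^ (k + 1) - w ^ k + c`, written in polar form. -/
theorem polar_root_iff (k : ℕ) (r θ c : ℝ) (hr : 0 < r) :
    ((r : ℂ) * exp (θ * I)) ^ (k + 1) - ((r : ℂ) * exp (θ * I)) ^ k + c = 0 ↔
      r * Real.cos ((k + 1) * θ) - Real.cos (k * θ) + c / r ^ k = 0 ∧
        r * Real.sin ((k + 1) * θ) = Real.sin (k * θ) := by
  have key : ∀ j : ℕ, ((r : ℂ) * exp (θ * I)) ^ j =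
      ((r ^ j * Real.cos (j * θ) : ℝ) : ℂ) + ((r ^ j * Real.sin (j * θ) : ℝ) : ℂ) * I := by
    intro j
    rw [mul_pow, ← exp_nat_mul, ← mul_assoc, exp_mul_I]
    push_cast
    ring
  have hrk : r ^ k ≠ 0 := (pow_pos hr k).ne'
  rw [key, key, Complex.ext_iff]
  simp only [add_re, sub_re, mul_re, ofReal_re, ofReal_im, I_re, I_im, add_im, sub_im, mul_im,
    zero_re, zero_im]
  push_cast
  constructor
  · rintro ⟨h1, h2⟩
    refine ⟨?_, mul_left_cancel₀ hrk ?_⟩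
    · field_simp
      rw [pow_succ] at h1
      linarith
    · rw [pow_succ] at h2
      linarith
  · rintro ⟨h1, h2⟩
    field_simp at h1
    refine ⟨?_, ?_⟩
    · rw [pow_succ]; linarith
    · have := congrArg (r ^ k * ·) h2
      rw [pow_succ]; linarith

/-- The difference is `2 sin(θ/2) cos((2k+1)θ/2)`; the cosine changes sign at `θ = π / (2k+1)`. -/
theorem sin_mul_lt_sin_succ_mul (k : ℕ) {θ : ℝ} (h0 : 0 < θ) (h1 : (2 * k + 1) * θ < Real.pi) :
    Real.sin (k * θ) < Real.sin ((k + 1) * θ) := by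
  have hk : (0 : ℝ) ≤ k := k.cast_nonneg
  have h := Real.sin_sub_sin ((k + 1) * θ) (k * θ)
  have hs : 0 < Real.sin (((k + 1) * θ - k * θ) / 2) :=
    Real.sin_pos_of_pos_of_lt_pi (by nlinarith) (by nlinarith)
  have hc : 0 < Real.cos (((k + 1) * θ + k * θ) / 2) :=
    Real.cos_pos_of_mem_Ioo ⟨by nlinarith [Real.pi_pos], by nlinarith⟩
  nlinarith [mul_pos hs hc]

theorem sin_succ_mul_le_sin_mul (k : ℕ) {θ : ℝ} (h0 : 0 < θ) (h1 : Real.pi ≤ (2 * k + 1) * θ)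
    (h2 : (k + 1) * θ < Real.pi) :
    Real.sin ((k + 1) * θ) ≤ Real.sin (k * θ) := by
  have hk : (0 : ℝ) ≤ k := k.cast_nonneg
  have h := Real.sin_sub_sin ((k + 1) * θ) (k * θ)
  have hs : 0 ≤ Real.sin (((k + 1) * θ - k * θ) / 2) :=
    Real.sin_nonneg_of_nonneg_of_le_pi (by nlinarith) (by nlinarith)
  have hc : Real.cos (((k + 1) * θ + k * θ) / 2) ≤ 0 :=
    Real.cos_nonpos_of_pi_div_two_le_of_le (by nlinarith) (by nlinarith)
  nlinarith [mul_nonneg hs (neg_nonneg.2 hc)]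

/-- In the open sector `0 < θ < π / (2 k + 1)` the curve on which `w ^ (k + 1) - w ^ k` is real
lies inside the unit disc. -/
theorem modulus_lt_one_of_sector (k : ℕ) {r θ : ℝ} (h0 : 0 < θ)
    (h1 : (2 * k + 1) * θ < Real.pi)
    (h : r * Real.sin ((k + 1) * θ) = Real.sin (k * θ)) : r < 1 := by
  have hk : (0 : ℝ) ≤ k := k.cast_nonneg
  have hlt := sin_mul_lt_sin_succ_mul k h0 h1
  have hs : 0 ≤ Real.sin (k * θ) :=
    Real.sin_nonneg_of_nonneg_of_le_pi (by positivity) (by nlinarith)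
  by_contra! hr
  nlinarith

theorem norm_lt_one_of_root (k : ℕ) {c : ℝ} (hc0 : 0 < c)
    (hc : c < 2 * Real.sin (Real.pi / (2 * (2 * k + 1)))) {w : ℂ}
    (hw : w ^ (k + 1) - w ^ k + c = 0) : ‖w‖ < 1 := by
  by_contra! hr
  have hk : (0 : ℝ) ≤ k := k.cast_nonneg
  have hr0 : 0 < ‖w‖ := by linarith
  have hpolar := Complex.norm_mul_exp_arg_mul_I w
  rw [← hpolar, polar_root_iff k _ _ c hr0] at hw
  obtain ⟨hre, him⟩ := hw
  set r := ‖w‖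
  set θ := w.arg
  have hd1 : c / r ^ k ≤ c := div_le_self hc0.le (one_le_pow₀ hr)
  have hd0 : 0 < c / r ^ k := by positivity
  set d := c / r ^ k
  -- `|1 - w| = d`
  have hsq : r ^ 2 - 2 * r * Real.cos θ + 1 = d ^ 2 := by
    have e : Real.cos θ = Real.cos ((k + 1) * θ) * Real.cos (k * θ) +
        Real.sin ((k + 1) * θ) * Real.sin (k * θ) := by
      rw [← Real.cos_sub]; congr 1; ring
    have e1 := Real.sin_sq_add_cos_sq ((k + 1) * θ)
    have e2 := Real.sin_sq_add_cos_sq (k * θ)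
    have e3 : d = Real.cos (k * θ) - r * Real.cos ((k + 1) * θ) := by linarith
    have e4 : (r * Real.sin ((k + 1) * θ) - Real.sin (k * θ)) ^ 2 = 0 := by rw [him]; ring
    rw [e, e3]
    linear_combination e4 - r ^ 2 * e1 - e2
  have hhalf : Real.cos θ = 1 - 2 * Real.sin (|θ| / 2) ^ 2 := by
    rw [← Real.cos_abs θ, show |θ| = 2 * (|θ| / 2) by ring, Real.cos_two_mul, Real.cos_sq']
    ring_nf
  have hθpi : |θ| ≤ Real.pi := Complex.abs_arg_le_pi w
  have hs0 : 0 ≤ Real.sin (|θ| / 2) :=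
    Real.sin_nonneg_of_nonneg_of_le_pi (by positivity) (by linarith [Real.pi_pos])
  -- `d² = (r - 1)² + 4 r sin²(|θ|/2)` with `r ≥ 1`.
  have hle : 2 * Real.sin (|θ| / 2) ≤ d := by
    apply le_of_sq_le_sq _ hd0.le
    nlinarith [Real.cos_le_one θ]
  have hlt : Real.sin (|θ| / 2) < Real.sin (Real.pi / (2 * (2 * k + 1))) := by linarith
  have hle' : Real.pi / (2 * (2 * k + 1)) ≤ Real.pi / 2 := by
    apply div_le_div_of_nonneg_left Real.pi_pos.le (by norm_num); linarith
  have hsmall : |θ| / 2 < Real.pi / (2 * (2 * k + 1)) := by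
    by_contra! hcon
    exact absurd (Real.sin_le_sin_of_le_of_le_pi_div_two
      (by have : 0 ≤ Real.pi / (2 * (2 * k + 1)) := by positivity
          linarith [Real.pi_pos]) (by linarith) hcon) (not_le.2 hlt)
  have hsector : (2 * k + 1) * |θ| < Real.pi := by
    rw [lt_div_iff₀ (by positivity)] at hsmall
    linarith
  have him' : r * Real.sin ((k + 1) * |θ|) = Real.sin (k * |θ|) := by
    rcases abs_choice θ with h | h <;> rw [h]
    · exact him
    · rw [mul_neg, mul_neg, Real.sin_neg, Real.sin_neg]; linarith
  -- A positive real root would give `r - 1 + d = 0`, impossible for `r ≥ 1` and `d > 0`.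
  rcases (abs_nonneg θ).eq_or_lt with h | h
  · have hz : θ = 0 := abs_eq_zero.1 h.symm
    rw [hz] at hre
    simp only [mul_zero, Real.cos_zero] at hre
    linarith
  · exact absurd (modulus_lt_one_of_sector k h hsector him') (not_lt.2 hr)

theorem exists_root_one_le_norm (k : ℕ) (hk : 0 < k) {c : ℝ}
    (hc : 2 * Real.sin (Real.pi / (2 * (2 * k + 1))) ≤ c) :
    ∃ w : ℂ, w ^ (k + 1) - w ^ k + c = 0 ∧ 1 ≤ ‖w‖ := by
  have hk1 : (1 : ℝ) ≤ k := by exact_mod_cast hk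
  have hpi := Real.pi_pos
  set α := Real.pi / (2 * k + 1) with hα
  set β := Real.pi / (k + 1) with hβ
  have hα0 : 0 < α := by positivity
  have hαm : (2 * k + 1) * α = Real.pi := by rw [hα]; field_simp
  have hβm : (k + 1) * β = Real.pi := by rw [hβ]; field_simp
  have hβ0 : 0 < β := by positivity
  have hαβ : α ≤ β := div_le_div_of_nonneg_left hpi.le (by positivity) (by linarith)
  -- Eliminating `r` gives `c = sin(kθ)^k sin θ / sin((k+1)θ)^(k+1)`, which equals `2 sin(α/2)` at
  -- `α` and blows up at `β`. Clearing the denominator keeps `f` continuous on `[α, β]`.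
  let f : ℝ → ℝ := fun θ =>
    c * Real.sin ((k + 1) * θ) ^ (k + 1) - Real.sin (k * θ) ^ k * Real.sin θ
  have hf : Continuous f := by fun_prop
  have hfα : 0 ≤ f α := by
    have e1 : Real.sin (k * α) = Real.sin ((k + 1) * α) := by
      rw [← Real.sin_pi_sub]; congr 1; linarith
    have e2 : Real.sin ((k + 1) * α) = Real.cos (α / 2) := by
      rw [← Real.cos_sub_pi_div_two]; congr 1; linarith
    have e3 : Real.sin α = 2 * Real.sin (α / 2) * Real.cos (α / 2) := by
      rw [← Real.sin_two_mul]; congr 1; ring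
    have e4 : Real.pi / (2 * (2 * k + 1)) = α / 2 := by rw [hα]; field_simp
    have hpos : 0 ≤ Real.cos (α / 2) :=
      Real.cos_nonneg_of_mem_Icc ⟨by linarith, by nlinarith⟩
    rw [e4] at hc
    have : f α = (c - 2 * Real.sin (α / 2)) * Real.cos (α / 2) ^ (k + 1) := by
      simp only [f]; rw [e1, e2, e3]; ring
    rw [this]
    exact mul_nonneg (by linarith) (pow_nonneg hpos _)
  have hfβ : f β < 0 := by
    have e1 : 0 < Real.sin (k * β) :=
      Real.sin_pos_of_pos_of_lt_pi (by positivity) (by linarith)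
    have e2 : 0 < Real.sin β := Real.sin_pos_of_pos_of_lt_pi hβ0 (by nlinarith)
    simp only [f]
    rw [hβm, Real.sin_pi, zero_pow (by omega), mul_zero, zero_sub, neg_lt_zero]
    positivity
  obtain ⟨θ, ⟨hθ1, hθ2⟩, hθ⟩ :=
    intermediate_value_Icc' hαβ hf.continuousOn (show (0 : ℝ) ∈ Set.Icc (f β) (f α) from
      ⟨hfβ.le, hfα⟩)
  have hθβ : θ < β := lt_of_le_of_ne hθ2 (by rintro rfl; linarith)
  have hθ0 : 0 < θ := by linarith
  have hlt : (k + 1) * θ < Real.pi := by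
    rw [← hβm]; exact mul_lt_mul_of_pos_left hθβ (by positivity)
  have hS : 0 < Real.sin ((k + 1) * θ) := Real.sin_pos_of_pos_of_lt_pi (by positivity) hlt
  have hle := sin_succ_mul_le_sin_mul k hθ0
    (by rw [← hαm]; exact mul_le_mul_of_nonneg_left hθ1 (by positivity)) hlt
  have hT : 0 < Real.sin (k * θ) := by linarith
  have hr0 : 0 < Real.sin (k * θ) / Real.sin ((k + 1) * θ) := by positivity
  refine ⟨((Real.sin (k * θ) / Real.sin ((k + 1) * θ) : ℝ) : ℂ) * Complex.exp (θ * Complex.I),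
    (polar_root_iff k _ θ c hr0).2 ⟨?_, div_mul_cancel₀ _ hS.ne'⟩, ?_⟩
  · have e : Real.sin θ = Real.sin ((k + 1) * θ) * Real.cos (k * θ) -
        Real.cos ((k + 1) * θ) * Real.sin (k * θ) := by
      rw [← Real.sin_sub]; congr 1; ring
    have hc' : c = Real.sin (k * θ) ^ k * Real.sin θ / Real.sin ((k + 1) * θ) ^ (k + 1) := by
      rw [eq_div_iff (by positivity)]
      simp only [f] at hθ
      linarith
    rw [hc', e, div_pow, pow_succ]
    generalize Real.sin ((k + 1) * θ) = S at hS
    generalize Real.sin (k * θ) = T at hT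
    field_simp
    ring
  · rw [norm_mul, Complex.norm_exp_ofReal_mul_I, mul_one, Complex.norm_real, Real.norm_eq_abs,
      abs_of_pos hr0, one_le_div hS]
    exact hle

/-- The stability criterion for `w ^ (k + 1) - w ^ k + c`. -/
theorem forall_root_norm_lt_one_iff (k : ℕ) (hk : 0 < k) {c : ℝ} (hc0 : 0 < c) :
    (∀ w : ℂ, w ^ (k + 1) - w ^ k + c = 0 → ‖w‖ < 1) ↔
      c < 2 * Real.sin (Real.pi / (2 * (2 * k + 1))) := by
  refine ⟨fun h => ?_, fun h w hw => norm_lt_one_of_root k hc0 h hw⟩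
  by_contra! hc
  obtain ⟨w, hw, hw1⟩ := exists_root_one_le_norm k hk hc
  exact absurd (h w hw) (not_lt.2 hw1)

theorem exists_one_le_pow_succ_sub_pow_eq (k : ℕ) {c : ℝ} (hc0 : 0 ≤ c) :
    ∃ x : ℝ, 1 ≤ x ∧ x ^ (k + 1) - x ^ k = c := by
  have hf : Continuous fun x : ℝ => x ^ (k + 1) - x ^ k := by fun_prop
  have hmem : c ∈ Set.Icc ((fun x : ℝ => x ^ (k + 1) - x ^ k) 1)
      ((fun x : ℝ => x ^ (k + 1) - x ^ k) (1 + c)) := by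
    refine ⟨by simpa using hc0, ?_⟩
    have : 1 ≤ (1 + c) ^ k := one_le_pow₀ (by linarith)
    simp only [pow_succ]
    nlinarith
  obtain ⟨x, hx, hxc⟩ := intermediate_value_Icc (by linarith) hf.continuousOn hmem
  exact ⟨x, hx.1, hxc⟩

/-- The angular form of the bound on `c`. -/
theorem lt_two_mul_sin_iff_arccos (k : ℕ) {c : ℝ} (hc0 : 0 < c) (hc1 : c < 1) :
    c < 2 * Real.sin (Real.pi / (2 * (2 * k + 1))) ↔
      k * Real.pi / (2 * k + 1) < Real.arccos (c / 2) ∧ Real.arccos (c / 2) < Real.pi / 2 := by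
  have hk : (0 : ℝ) ≤ k := k.cast_nonneg
  have hpi := Real.pi_pos
  have h2 : Real.arccos (c / 2) < Real.pi / 2 := Real.arccos_lt_pi_div_two.2 (by linarith)
  rw [and_iff_left h2]
  have h0 : 0 ≤ k * Real.pi / (2 * k + 1) := by positivity
  have hle : k * Real.pi / (2 * k + 1) ≤ Real.pi := by
    rw [div_le_iff₀ (by positivity)]; nlinarith
  -- The two angles add up to `π / 2`.
  have e : Real.sin (Real.pi / (2 * (2 * k + 1))) = Real.cos (k * Real.pi / (2 * k + 1)) := by
    rw [← Real.cos_pi_div_two_sub]; congr 1; field_simp; ring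
  rw [e, ← (Real.strictAntiOn_cos.lt_iff_gt
    (⟨Real.arccos_nonneg _, Real.arccos_le_pi _⟩ : Real.arccos (c / 2) ∈ Set.Icc 0 Real.pi)
    (⟨h0, hle⟩ : k * Real.pi / (2 * k + 1) ∈ Set.Icc 0 Real.pi)),
    Real.cos_arccos (by linarith) (by linarith)]
  constructor <;> intro h <;> linarith

/-- Under `ζ = -w` the trinomial `ζ ^ (k + 1) + ζ ^ k - (-1) ^ k c` becomes
`w ^ (k + 1) - w ^ k + c` up to sign. -/
theorem isSchurStable_neg_one_pow_iff (k : ℕ) (c : ℂ) :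
    IsSchurStable (k + 1) k 1 1 (-((-1) ^ k * c)) ↔
      ∀ w : ℂ, w ^ (k + 1) - w ^ k + c = 0 → ‖w‖ < 1 := by
  have key : ∀ w : ℂ, 1 * (-w) ^ (k + 1) + 1 * (-w) ^ k + -((-1) ^ k * c) =
      -(-1) ^ k * (w ^ (k + 1) - w ^ k + c) := by
    intro w
    rw [neg_pow, neg_pow w k]
    ring
  constructor
  · intro h w hw
    rw [← norm_neg]
    exact h _ (by rw [key, hw, mul_zero])
  · intro h ζ hζ
    rw [← norm_neg]
    rw [← neg_neg ζ, key] at hζ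
    exact h _ ((mul_eq_zero.1 hζ).resolve_left (by simp))

theorem point_mem_stabilityRegion_iff_arccos (k : ℕ) (hk : 0 < k) {c : ℝ} (hc0 : 0 < c)
    (hc1 : c < 1) :
    point 1 (-((-1) ^ k * (c : ℂ))) ∈ stabilityRegion (k + 1) k ↔
      k * Real.pi / (2 * k + 1) < Real.arccos (c / 2) ∧ Real.arccos (c / 2) < Real.pi / 2 := by
  rw [point_mem_stabilityRegion_iff _ _ one_ne_zero (by simpa using hc0.ne'),
    isSchurStable_neg_one_pow_iff, forall_root_norm_lt_one_iff k hk hc0,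
    lt_two_mul_sin_iff_arccos k hc0 hc1]

theorem point_notMem_stabilityRegion (k : ℕ) {c : ℝ} (hc0 : 0 < c) :
    point 1 ((-1) ^ k * (c : ℂ)) ∉ stabilityRegion (k + 1) k := by
  rw [point_mem_stabilityRegion_iff _ _ one_ne_zero (by simpa using hc0.ne'),
    -- The substitution `ζ = -w` is applied with `-c` in place of `c`.
    show (-1 : ℂ) ^ k * c = -((-1) ^ k * (-c)) by ring, isSchurStable_neg_one_pow_iff]
  intro h
  obtain ⟨x, hx1, hx⟩ := exists_one_le_pow_succ_sub_pow_eq k hc0.le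
  have := h x (by rw [← hx]; push_cast; ring)
  rw [Complex.norm_real, Real.norm_eq_abs, abs_of_nonneg (by linarith)] at this
  linarith

end Trinomial

theorem corollary1p11 (n m : ℕ) (hm : 0 < m) (hmn : m < n) (hm' : m = n - 1)
    (c : ℝ) (hc0 : 0 < c) (hc1 : c < 1) :
    (Odd n →
      Trinomial.point 1 (c : ℂ) ∉ Trinomial.stabilityRegion n m ∧
      (Trinomial.point 1 (-(c : ℂ)) ∈ Trinomial.stabilityRegion n m ↔
        ((n : ℝ) - 1) * Real.pi / (2 * (n : ℝ) - 1) < Real.arccos (c / 2) ∧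
          Real.arccos (c / 2) < Real.pi / 2)) ∧
    (Even n →
      Trinomial.point 1 (-(c : ℂ)) ∉ Trinomial.stabilityRegion n m ∧
      (Trinomial.point 1 (c : ℂ) ∈ Trinomial.stabilityRegion n m ↔
        ((n : ℝ) - 1) * Real.pi / (2 * (n : ℝ) - 1) < Real.arccos (c / 2) ∧
          Real.arccos (c / 2) < Real.pi / 2)) := by
  obtain rfl : n = m + 1 := by omega
  have e1 : ((m + 1 : ℕ) : ℝ) - 1 = m := by push_cast; ring
  have e2 : 2 * ((m + 1 : ℕ) : ℝ) - 1 = 2 * m + 1 := by push_cast; ring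
  have hstable := Trinomial.point_mem_stabilityRegion_iff_arccos m hm hc0 hc1
  have hunstable := Trinomial.point_notMem_stabilityRegion m hc0
  rw [e1, e2]
  constructor
  · intro hodd
    have hpar : Even m := by
      rcases hodd with ⟨j, hj⟩
      exact ⟨j, by omega⟩
    rw [hpar.neg_one_pow, one_mul] at hstable hunstable
    exact ⟨hunstable, hstable⟩
  · intro heven
    have hpar : Odd m := by
      rcases heven with ⟨j, hj⟩
      exact ⟨j - 1, by omega⟩
    rw [hpar.neg_one_pow, neg_one_mul] at hstable hunstable
    rw [neg_neg] at hstable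
    exact ⟨hunstable, hstable⟩
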